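/- Let $0<\delta\le 1/2$, $0<\epsilon\le 1$ and let $\Delta\ge 3$ be an integer. A bicoloured graph is a finite simple graph $\mathcal G$ with nodes $\{0,\dots,n-1\}$, each coloured red or blue so that adjacent nodes have different colours, in which every node has a linear order (its preferences) on its neighbours. A matching $M$ in $\mathcal G$ is stable if there is no edge $\{u,v\}\notin M$ of $\mathcal G$ such that each of $u,v$ is unmatched in $M$ or prefers the other one over its match in $M$. A preference oracle for $\mathcal G$, queried with a node, replies with the colour of the node and its neighbours listed in order of preference. There exists a randomised algorithm (depending only on $\delta,\epsilon,\Delta$) such that for every $n$ and every bicoloured graph $\mathcal G$ on $n$ nodes without isolated nodes and with all degrees at most $\Delta$ the following holds. Given $n$ and access to a preference oracle for $\mathcal G$, the algorithm, for every outcome of its random choices, stops after making at most $$25000\,\epsilon^{-2}\,(\Delta-1)^{3+4\Delta/\epsilon}\,\ln\delta^{-1}$$ queries to the oracle and outputs a number $\hat m$. Moreover, $\mathcal G$ has a stable matching, and for every stable matching $M$ in $\mathcal G$, with probability at least $1-\delta$, $$\bigl|\hat m-|M|\bigr|\le\epsilon\,|M|.$$ -/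

import Mathlib

/-- A bicoloured graph with matching preferences: a simple graph whose nodes are coloured red
(`true`) or blue (`false`) so that adjacent nodes have different colours; each node `v` has a linear
order on its neighbours, given as the list `pref v` of all of them without repetition, most
preferred first. -/
structure BicolouredGraph (V : Type*) where
  graph : SimpleGraph V
  isRed : V → Bool
  isRed_ne : ∀ u v, graph.Adj u v → isRed u ≠ isRed v
  pref : V → List V
  pref_nodup : ∀ v, (pref v).Nodup
  mem_pref : ∀ v u, u ∈ pref v ↔ graph.Adj v u

namespace BicolouredGraph

section Matchings

variable {V : Type*} (G : BicolouredGraph V)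

/-- No node is isolated. -/
def NoIsolated : Prop := ∀ v, ∃ u, G.graph.Adj v u

/-- The number of neighbours of `v`. -/
def deg (v : V) : ℕ := (G.pref v).length

variable [DecidableEq V]

/-- The node `v` prefers its neighbour `x` over its neighbour `y`. -/
def Prefers (v x y : V) : Prop :=
  x ∈ G.pref v ∧ y ∈ G.pref v ∧ (G.pref v).idxOf x < (G.pref v).idxOf y

/-- The edge `{u, v}` of the graph is unstable relative to the matching `M`: it is not in `M`, and
each of its ends is unmatched in `M` or prefers the other end over its match in `M`. -/
def Unstable (M : G.graph.Subgraph) (u v : V) : Prop :=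
  G.graph.Adj u v ∧ ¬ M.Adj u v ∧
    (∀ w, M.Adj u w → G.Prefers u v w) ∧ (∀ w, M.Adj v w → G.Prefers v u w)

/-- `M` is a stable matching. -/
def IsStableMatching (M : G.graph.Subgraph) : Prop :=
  M.IsMatching ∧ ∀ u v, ¬ G.Unstable M u v

end Matchings

/-- One entry of a transcript of the communication with the preference oracle: the queried node,
its colour, and the list of its neighbours in order of preference, most preferred first. Nodes are
named by natural numbers. -/
abbrev OracleEntry : Type := ℕ × Bool × List ℕ

/-- The preference oracle for a graph with nodes `0, …, n - 1`: the entry added to the transcript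
by a query to the node `v`. -/
def reply {n : ℕ} (G : BicolouredGraph (Fin n)) (v : Fin n) : OracleEntry :=
  (v.val, G.isRed v, (G.pref v).map Fin.val)

end BicolouredGraph

open BicolouredGraph (OracleEntry) in
/-- A randomised algorithm with access to a preference oracle. Its input is the number `n` of
nodes. It draws `draws n` independent uniform random elements of `{0, …, range n - 1}`; then it
repeatedly computes, from `n`, the random draws and the transcript of the queries made so far,
its next action, which is either to query the oracle with a node (`Sum.inl v`) or to stop and
output the fraction `a / b` (`Sum.inr (a, b)`). All these computations are effective. -/
structure OracleAlgorithm where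
  draws : ℕ → ℕ
  range : ℕ → ℕ
  range_pos : ∀ n, 0 < range n
  next : ℕ × List ℕ × List OracleEntry → ℕ ⊕ (ℕ × ℕ)
  draws_computable : Computable draws
  range_computable : Computable range
  next_computable : Computable next

namespace OracleAlgorithm

open BicolouredGraph (OracleEntry)

variable (A : OracleAlgorithm)

/-- The possible outcomes of the random draws, all of them equally likely. -/
abbrev Seed (n : ℕ) : Type := Fin (A.draws n) → Fin (A.range n)

/-- The probability of the event `P` over the random draws. -/
noncomputable def prob (n : ℕ) (P : A.Seed n → Prop) : ℝ :=
  (Nat.card {ω : A.Seed n // P ω} : ℝ) / (Nat.card (A.Seed n) : ℝ)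

/-- `A.Run G ω t q m`: with random draws `ω` and transcript `t`, the algorithm makes exactly `q`
further queries to the preference oracle for `G`, each of them with a node of `G`, and then stops
with output `m`. -/
inductive Run {n : ℕ} (G : BicolouredGraph (Fin n)) (ω : A.Seed n) :
    List OracleEntry → ℕ → ℝ → Prop
  | output {t : List OracleEntry} (a b : ℕ) (hb : b ≠ 0)
      (h : A.next (n, List.ofFn (fun i => (ω i).val), t) = Sum.inr (a, b)) :
      Run G ω t 0 ((a : ℝ) / (b : ℝ))
  | query {t : List OracleEntry} {q : ℕ} {m : ℝ} (v : Fin n)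
      (h : A.next (n, List.ofFn (fun i => (ω i).val), t) = Sum.inl v.val)
      (hr : Run G ω (t ++ [G.reply v]) q m) :
      Run G ω t (q + 1) m

end OracleAlgorithm

/-! Let all nodes of both colours propose at once, each moving down its list when rejected; this
superposes red-proposing and blue-proposing deferred acceptance. Stop after `k` rounds. For any
stable matching `M`, no node has been rejected by its match (`rejections_le_idxOf`) and every node
receiving a proposal is matched (`exists_adj_of_proposes`). So `engaged k ⊆ matched M ⊆ hopeful k`,
and by `card_hopeful` the outer sizes differ by the number of proposals being rejected. That number
never grows with `k`, and the rejections issued so far total at most `Δ - 1` per engaged node, so it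
is at most `(Δ - 1) / k` times the number of engaged nodes (`mul_card_rejected_le`). With `k` about
`2 (Δ - 1) / ε`, half the number of hopeful nodes lies between `|M|` and `(1 + ε / 2) |M|`, for all
stable `M` simultaneously.

Whether a node is hopeful depends only on its ball of radius `2 * k` (`Agrees.rejections_eq`), so
the density of hopeful nodes can be estimated by sampling. `rivals` and `rejections` take bare
preference lists so that the same functions run on an oracle transcript. The additive sampling error
becomes a relative one because, without isolated nodes, at least `n / Δ` nodes are matched
(`card_le_mul_card_matched`). `card_ball_le` bounds the queries per sample, and an exponential
moment bound gives the number of samples. -/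

/-! ### The truncated deferred-acceptance dynamics -/

section Dynamics

variable {V : Type*} [DecidableEq V]

/-- The neighbours that compete with `v` for its current favourite `b` and that `b` prefers over
`v`, when each node `u` proposes to entry number `c u` of its preference list. -/
def rivals (nb : V → List V) (c : V → ℕ) (v : V) : List V :=
  (nb v)[c v]?.toList.flatMap fun b =>
    ((nb b).take ((nb b).idxOf v)).filterMap fun r =>
      if (nb r)[c r]? = some b then some r else none

/-- The number of rejections that `v` has received after `k` rounds in which all nodes
simultaneously propose. -/
def rejections (nb : V → List V) : ℕ → V → ℕ
  | 0 => fun _ => 0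
  | k + 1 => fun v =>
      if rivals nb (rejections nb k) v = [] then rejections nb k v else rejections nb k v + 1

theorem List.mem_take_idxOf {l : List V} {r v : V} :
    r ∈ l.take (l.idxOf v) ↔ r ∈ l ∧ l.idxOf r < l.idxOf v := by
  induction l with
  | nil => simp
  | cons a l ih =>
    by_cases hv : a = v
    · subst hv; simp
    · rw [List.idxOf_cons_ne _ hv, List.take_succ_cons, List.mem_cons, ih, List.mem_cons]
      by_cases hr : a = r
      · subst hr; simp
      · rw [List.idxOf_cons_ne _ hr]
        have : r ≠ a := fun h => hr h.symm
        simp [this]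

theorem mem_rivals {nb : V → List V} {c : V → ℕ} {v r : V} :
    r ∈ rivals nb c v ↔ ∃ b, (nb v)[c v]? = some b ∧ (nb r)[c r]? = some b ∧
      r ∈ nb b ∧ (nb b).idxOf r < (nb b).idxOf v := by
  simp only [rivals, List.mem_flatMap, Option.mem_toList, List.mem_filterMap,
    List.mem_take_idxOf]
  constructor
  · rintro ⟨b, hb, a, ⟨ha, hlt⟩, h⟩
    split_ifs at h with h'
    · cases h
      exact ⟨b, hb, h', ha, hlt⟩
  · rintro ⟨b, hb, h', ha, hlt⟩
    exact ⟨b, hb, r, ⟨ha, hlt⟩, by simp [h']⟩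

theorem rejections_succ_of_eq_nil {nb : V → List V} {k : ℕ} {v : V}
    (h : rivals nb (rejections nb k) v = []) :
    rejections nb (k + 1) v = rejections nb k v := by
  simp [rejections, h]

theorem rejections_succ_of_ne_nil {nb : V → List V} {k : ℕ} {v : V}
    (h : rivals nb (rejections nb k) v ≠ []) :
    rejections nb (k + 1) v = rejections nb k v + 1 := by
  simp [rejections, h]

theorem rejections_le_succ (nb : V → List V) (k : ℕ) (v : V) :
    rejections nb k v ≤ rejections nb (k + 1) v := by
  by_cases h : rivals nb (rejections nb k) v = []
  · rw [rejections_succ_of_eq_nil h]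
  · rw [rejections_succ_of_ne_nil h]; omega

theorem lt_length_of_rivals_ne_nil {nb : V → List V} {c : V → ℕ} {v : V}
    (h : rivals nb c v ≠ []) : c v < (nb v).length := by
  obtain ⟨r, hr⟩ := List.exists_mem_of_ne_nil _ h
  obtain ⟨b, hb, -⟩ := mem_rivals.1 hr
  exact (List.getElem?_eq_some_iff.1 hb).1

theorem rejections_le_length (nb : V → List V) (k : ℕ) (v : V) :
    rejections nb k v ≤ (nb v).length := by
  induction k with
  | zero => simp [rejections]
  | succ k ih =>
    by_cases h : rivals nb (rejections nb k) v = []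
    · rwa [rejections_succ_of_eq_nil h]
    · rw [rejections_succ_of_ne_nil h]; exact lt_length_of_rivals_ne_nil h

theorem List.Nodup.idxOf_of_getElem? {l : List V} (hl : l.Nodup) {i : ℕ} {b : V}
    (h : l[i]? = some b) : l.idxOf b = i := by
  obtain ⟨hi, rfl⟩ := List.getElem?_eq_some_iff.1 h
  exact hl.idxOf_getElem i hi

end Dynamics

/-! ### Proposals and rejections in a bicoloured graph -/

namespace BicolouredGraph

theorem mem_pref_comm {V : Type*} {G : BicolouredGraph V} {u v : V} : u ∈ G.pref v ↔ v ∈ G.pref u := by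
  rw [G.mem_pref, G.mem_pref, G.graph.adj_comm]

variable {V : Type*} [DecidableEq V] (G : BicolouredGraph V)

/-- After `k` rounds, `v` proposes to `b`. -/
def Proposes (k : ℕ) (v b : V) : Prop :=
  (G.pref v)[rejections G.pref k v]? = some b

variable {G}

theorem Proposes.mem {k : ℕ} {v b : V} (h : G.Proposes k v b) : b ∈ G.pref v :=
  List.mem_of_getElem? h

theorem Proposes.adj {k : ℕ} {v b : V} (h : G.Proposes k v b) : G.graph.Adj v b :=
  (G.mem_pref v b).1 h.mem

theorem Proposes.idxOf_eq {k : ℕ} {v b : V} (h : G.Proposes k v b) :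
    (G.pref v).idxOf b = rejections G.pref k v :=
  (G.pref_nodup v).idxOf_of_getElem? h

theorem Proposes.eq {k : ℕ} {v b b' : V} (h : G.Proposes k v b) (h' : G.Proposes k v b') :
    b = b' :=
  Option.some.inj (h.symm.trans h')

theorem proposes_of_eq {k : ℕ} {v b : V} (hb : b ∈ G.pref v)
    (h : rejections G.pref k v = (G.pref v).idxOf b) : G.Proposes k v b := by
  rw [Proposes, h, List.getElem?_idxOf hb]

theorem exists_proposes_of_lt {k : ℕ} {v : V} (h : rejections G.pref k v < (G.pref v).length) :
    ∃ b, G.Proposes k v b :=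
  ⟨_, List.getElem?_eq_getElem h⟩

theorem Proposes.lt_length {k : ℕ} {v b : V} (h : G.Proposes k v b) :
    rejections G.pref k v < (G.pref v).length :=
  (List.getElem?_eq_some_iff.1 h).1

theorem Proposes.mem_rivals_iff {k : ℕ} {v b r : V} (h : G.Proposes k v b) :
    r ∈ rivals G.pref (rejections G.pref k) v ↔
      G.Proposes k r b ∧ (G.pref b).idxOf r < (G.pref b).idxOf v := by
  rw [mem_rivals]
  constructor
  · rintro ⟨b', hb', hr, hm, hlt⟩
    cases h.eq hb'
    exact ⟨hr, hlt⟩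
  · rintro ⟨hr, hlt⟩
    exact ⟨b, h, hr, mem_pref_comm.1 hr.mem, hlt⟩

/-- A node that receives a proposal has a best proposer, who is not rejected. -/
theorem Proposes.exists_best {k : ℕ} {v b : V} (h : G.Proposes k v b) :
    ∃ v', G.Proposes k v' b ∧ rivals G.pref (rejections G.pref k) v' = [] ∧
      (G.pref b).idxOf v' ≤ (G.pref b).idxOf v := by
  induction hi : (G.pref b).idxOf v using Nat.strong_induction_on generalizing v with
  | _ i ih =>
    by_cases hr : rivals G.pref (rejections G.pref k) v = []
    · exact ⟨v, h, hr, hi.le⟩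
    · obtain ⟨r, hr⟩ := List.exists_mem_of_ne_nil _ hr
      obtain ⟨hr, hlt⟩ := h.mem_rivals_iff.1 hr
      obtain ⟨v', h1, h2, h3⟩ := ih _ (hi ▸ hlt) hr rfl
      exact ⟨v', h1, h2, by omega⟩

theorem Proposes.succ {k : ℕ} {v b : V} (h : G.Proposes k v b)
    (hv : rivals G.pref (rejections G.pref k) v = []) : G.Proposes (k + 1) v b := by
  rw [Proposes, rejections_succ_of_eq_nil hv]; exact h

/-- A rejection is issued only in favour of a better proposer, and the best proposer of a round
repeats its proposal in the next one. So the best offer held by `b` never gets worse. -/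
theorem exists_proposes_of_idxOf_lt {k : ℕ} {v b : V} (hb : b ∈ G.pref v)
    (h : (G.pref v).idxOf b < rejections G.pref k v) :
    ∃ v', G.Proposes k v' b ∧ (G.pref b).idxOf v' < (G.pref b).idxOf v := by
  induction k with
  | zero => simp [rejections] at h
  | succ k ih =>
    have key : ∃ v', G.Proposes k v' b ∧ (G.pref b).idxOf v' < (G.pref b).idxOf v := by
      by_cases hlt : (G.pref v).idxOf b < rejections G.pref k v
      · exact ih hlt
      · by_cases hr : rivals G.pref (rejections G.pref k) v = []
        · rw [rejections_succ_of_eq_nil hr] at h; exact absurd h hlt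
        · rw [rejections_succ_of_ne_nil hr] at h
          have hp : G.Proposes k v b := proposes_of_eq hb (by omega)
          obtain ⟨r, hr⟩ := List.exists_mem_of_ne_nil _ hr
          exact ⟨r, hp.mem_rivals_iff.1 hr⟩
    obtain ⟨v', h1, h2⟩ := key
    obtain ⟨v'', h3, h4, h5⟩ := h1.exists_best
    exact ⟨v'', h3.succ h4, by omega⟩

/-! ### Comparison with a stable matching -/

theorem IsStableMatching.eq_of_adj {M : G.graph.Subgraph} (hM : G.IsStableMatching M) {u v w : V}
    (hv : M.Adj u v) (hw : M.Adj u w) : v = w :=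
  (hM.1 (M.edge_vert hv)).unique hv hw

/-- Consider a first rejection of some `v` by its match `b`, in favour of `r`. Until then `r` has
not been rejected by its own match, so it ranks `b` above that match, if it has one; hence `{r, b}`
is unstable. -/
theorem IsStableMatching.rejections_le_idxOf {M : G.graph.Subgraph} (hM : G.IsStableMatching M)
    (k : ℕ) {v b : V} (h : M.Adj v b) : rejections G.pref k v ≤ (G.pref v).idxOf b := by
  induction k generalizing v b with
  | zero => simp [rejections]
  | succ k ih =>
    have hb : b ∈ G.pref v := (G.mem_pref v b).2 h.adj_sub
    by_cases hr : rivals G.pref (rejections G.pref k) v = []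
    · rw [rejections_succ_of_eq_nil hr]; exact ih h
    · rw [rejections_succ_of_ne_nil hr]
      refine (ih h).lt_of_ne fun he => ?_
      obtain ⟨r, hr⟩ := List.exists_mem_of_ne_nil _ hr
      obtain ⟨hr, hlt⟩ := (proposes_of_eq hb he).mem_rivals_iff.1 hr
      have hrb : ¬ M.Adj r b := fun h' => by
        cases hM.eq_of_adj h.symm h'.symm
        exact lt_irrefl _ hlt
      refine hM.2 r b ⟨hr.adj, hrb, fun w hw => ?_, fun w hw => ?_⟩
      · have hw' : w ∈ G.pref r := (G.mem_pref r w).2 hw.adj_sub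
        refine ⟨hr.mem, hw', ?_⟩
        have h1 := ih hw
        rw [← hr.idxOf_eq] at h1
        refine h1.lt_of_ne fun h2 => hrb ?_
        rwa [(List.idxOf_inj hr.mem).1 h2]
      · cases hM.eq_of_adj h.symm hw
        exact ⟨mem_pref_comm.1 hr.mem, mem_pref_comm.1 hb, hlt⟩

theorem IsStableMatching.exists_adj_of_proposes {M : G.graph.Subgraph}
    (hM : G.IsStableMatching M) {k : ℕ} {v b : V} (h : G.Proposes k v b) : ∃ w, M.Adj b w := by
  by_contra hb
  push Not at hb
  have hvb : ¬ M.Adj v b := fun h' => hb _ h'.symm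
  refine hM.2 v b ⟨h.adj, hvb, fun w hw => ⟨h.mem, (G.mem_pref v w).2 hw.adj_sub, ?_⟩,
    fun w hw => absurd hw (hb w)⟩
  have h1 := hM.rejections_le_idxOf k hw
  rw [← h.idxOf_eq] at h1
  refine h1.lt_of_ne fun h2 => hvb ?_
  rwa [(List.idxOf_inj h.mem).1 h2]

theorem Unstable.symm {M : G.graph.Subgraph} {u v : V} (h : G.Unstable M u v) :
    G.Unstable M v u :=
  ⟨h.1.symm, fun h' => h.2.1 h'.symm, h.2.2.2, h.2.2.1⟩

/-! ### Counting -/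

section Counting

variable [Fintype V] (G)

open Finset Classical in
/-- The nodes that have not been rejected by all their neighbours in `k` rounds. -/
noncomputable def hopeful (k : ℕ) : Finset V := {v | rejections G.pref k v < (G.pref v).length}

open Finset Classical in
/-- The nodes that receive a proposal after `k` rounds. -/
noncomputable def engaged (k : ℕ) : Finset V := {b | ∃ v, G.Proposes k v b}

open Finset Classical in
/-- The nodes whose proposal after `k` rounds is rejected. -/
noncomputable def rejected (k : ℕ) : Finset V :=
  {v | rivals G.pref (rejections G.pref k) v ≠ []}

open Finset Classical in
/-- The nodes matched by `M`. -/
noncomputable def matched (M : G.graph.Subgraph) : Finset V := {v | ∃ w, M.Adj v w}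

variable {G}

open Finset

/-- A hopeful node is either rejected or the best proposer of its current target; sending nodes of
the second kind to their targets is a bijection onto the engaged nodes. -/
theorem card_hopeful (k : ℕ) : #(G.hopeful k) = #(G.engaged k) + #(G.rejected k) := by
  classical
  have hsub : G.rejected k ⊆ G.hopeful k := fun v hv => by
    simp only [rejected, hopeful, mem_filter, mem_univ, true_and] at hv ⊢
    exact lt_length_of_rivals_ne_nil hv
  have hbij : #(G.engaged k) = #(G.hopeful k \ G.rejected k) := by
    symm
    refine card_bij
      (fun v hv => (G.pref v)[rejections G.pref k v]'(by simp [hopeful] at hv; exact hv.1))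
      ?_ ?_ ?_
    · intro v hv
      simp only [hopeful, mem_sdiff, mem_filter, mem_univ, true_and] at hv
      simp only [engaged, mem_filter, mem_univ, true_and]
      exact ⟨v, List.getElem?_eq_getElem hv.1⟩
    · intro v hv w hw h
      simp only [hopeful, rejected, mem_sdiff, mem_filter, mem_univ, true_and, not_not] at hv hw
      have hpv : G.Proposes k v _ := List.getElem?_eq_getElem hv.1
      have hpw : G.Proposes k w _ := List.getElem?_eq_getElem hw.1
      rw [← h] at hpw
      rcases lt_trichotomy ((G.pref (G.pref v)[rejections G.pref k v]).idxOf v)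
        ((G.pref (G.pref v)[rejections G.pref k v]).idxOf w) with hlt | he | hlt
      · have := hpw.mem_rivals_iff.2 ⟨hpv, hlt⟩
        simp [hw.2] at this
      · exact (List.idxOf_inj (mem_pref_comm.1 hpv.mem)).1 he
      · have := hpv.mem_rivals_iff.2 ⟨hpw, hlt⟩
        simp [hv.2] at this
    · intro b hb
      simp only [engaged, mem_filter, mem_univ, true_and] at hb
      obtain ⟨v, hv⟩ := hb
      obtain ⟨v', h1, h2, -⟩ := hv.exists_best
      refine ⟨v', ?_, ?_⟩
      · simp only [hopeful, rejected, mem_sdiff, mem_filter, mem_univ, true_and, not_not]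
        exact ⟨h1.lt_length, h2⟩
      · exact (List.getElem?_eq_some_iff.1 h1).2
  rw [hbij, card_sdiff_of_subset hsub]
  have := card_le_card hsub
  omega

theorem hopeful_succ_subset (k : ℕ) : G.hopeful (k + 1) ⊆ G.hopeful k := fun v hv => by
  simp only [hopeful, mem_filter, mem_univ, true_and] at hv ⊢
  exact (rejections_le_succ _ _ _).trans_lt hv

theorem engaged_subset_succ (k : ℕ) : G.engaged k ⊆ G.engaged (k + 1) := fun b hb => by
  simp only [engaged, mem_filter, mem_univ, true_and] at hb ⊢
  obtain ⟨v, hv⟩ := hb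
  obtain ⟨v', h1, h2, -⟩ := hv.exists_best
  exact ⟨v', h1.succ h2⟩

/-- Hopeful nodes only get fewer and engaged nodes only more numerous, so the difference shrinks. -/
theorem card_rejected_antitone : Antitone fun k => #(G.rejected k) :=
  antitone_nat_of_succ_le fun k => by
    have h1 := card_hopeful (G := G) k
    have h2 := card_hopeful (G := G) (k + 1)
    have h3 := card_le_card (G.hopeful_succ_subset k)
    have h4 := card_le_card (G.engaged_subset_succ k)
    omega

theorem sum_rejections (k : ℕ) :
    ∑ v, rejections G.pref k v = ∑ t ∈ range k, #(G.rejected t) := by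
  classical
  induction k with
  | zero => simp [rejections]
  | succ k ih =>
    rw [sum_range_succ, ← ih, rejected, card_filter, ← sum_add_distrib]
    refine sum_congr rfl fun v _ => ?_
    by_cases h : rivals G.pref (rejections G.pref k) v = []
    · rw [rejections_succ_of_eq_nil h, if_neg (by simpa using h), add_zero]
    · rw [rejections_succ_of_ne_nil h, if_pos h]

/-- Double counting of the pairs `(v, b)` such that `b` has rejected `v`. Such a `b` is engaged, and
a current proposer is a neighbour that it has not rejected so far, which saves one in `Δ`. -/
theorem sum_rejections_le {Δ : ℕ} (hdeg : ∀ v, G.deg v ≤ Δ) (k : ℕ) :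
    ∑ v, rejections G.pref k v ≤ (Δ - 1) * #(G.engaged k) := by
  classical
  have hrow : ∀ v, rejections G.pref k v =
      ∑ b, if b ∈ G.pref v ∧ (G.pref v).idxOf b < rejections G.pref k v then 1 else 0 := by
    intro v
    rw [← card_filter]
    have : ({b | b ∈ G.pref v ∧ (G.pref v).idxOf b < rejections G.pref k v} : Finset V)
        = ((G.pref v).take (rejections G.pref k v)).toFinset := by
      ext b
      simp only [mem_filter, mem_univ, true_and, List.mem_toFinset]
      rw [List.mem_take_iff_getElem]
      constructor
      · rintro ⟨hb, hlt⟩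
        exact ⟨_, lt_min hlt (List.idxOf_lt_length_of_mem hb), List.getElem_idxOf _⟩
      · rintro ⟨i, hi, rfl⟩
        refine ⟨List.getElem_mem _, ?_⟩
        rw [(G.pref_nodup v).idxOf_getElem]
        exact (lt_min_iff.1 hi).1
    rw [this, List.toFinset_card_of_nodup ((G.pref_nodup v).sublist (List.take_sublist _ _)),
      List.length_take, min_eq_left (rejections_le_length _ _ _)]
  rw [sum_congr rfl fun v _ => hrow v, sum_comm, mul_comm, ← smul_eq_mul, ← sum_const]
  rw [← sum_subset (subset_univ (G.engaged k))]
  · refine sum_le_sum fun b hb => ?_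
    simp only [engaged, mem_filter, mem_univ, true_and] at hb
    obtain ⟨v, hv⟩ := hb
    rw [← card_filter]
    calc _ ≤ #((G.pref b).toFinset.erase v) := card_le_card fun u hu => by
            simp only [mem_filter, mem_univ, true_and] at hu
            simp only [mem_erase, List.mem_toFinset]
            refine ⟨?_, mem_pref_comm.1 hu.1⟩
            rintro rfl
            exact hu.2.ne hv.idxOf_eq
      _ = G.deg b - 1 := by
            rw [card_erase_of_mem (by simpa using mem_pref_comm.1 hv.mem),
              List.toFinset_card_of_nodup (G.pref_nodup b), deg]
      _ ≤ Δ - 1 := Nat.sub_le_sub_right (hdeg b) 1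
  · intro b _ hb
    simp only [engaged, mem_filter, mem_univ, true_and] at hb
    refine sum_eq_zero fun v _ => if_neg fun h => hb ?_
    obtain ⟨v', h', -⟩ := exists_proposes_of_idxOf_lt h.1 h.2
    exact ⟨v', h'⟩

theorem mul_card_rejected_le {Δ : ℕ} (hdeg : ∀ v, G.deg v ≤ Δ) (k : ℕ) :
    k * #(G.rejected k) ≤ (Δ - 1) * #(G.engaged k) := by
  refine le_trans ?_ (sum_rejections_le hdeg k)
  rw [sum_rejections, ← smul_eq_mul, ← card_range k, ← sum_const, card_range]
  exact sum_le_sum fun t ht => card_rejected_antitone (mem_range.1 ht).le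

theorem IsStableMatching.matched_subset_hopeful {M : G.graph.Subgraph}
    (hM : G.IsStableMatching M) (k : ℕ) : G.matched M ⊆ G.hopeful k := fun v hv => by
  simp only [matched, hopeful, mem_filter, mem_univ, true_and] at hv ⊢
  obtain ⟨w, hw⟩ := hv
  exact (hM.rejections_le_idxOf k hw).trans_lt
    (List.idxOf_lt_length_of_mem ((G.mem_pref v w).2 hw.adj_sub))

theorem IsStableMatching.engaged_subset_matched {M : G.graph.Subgraph}
    (hM : G.IsStableMatching M) (k : ℕ) : G.engaged k ⊆ G.matched M := fun v hv => by
  simp only [matched, engaged, mem_filter, mem_univ, true_and] at hv ⊢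
  obtain ⟨w, hw⟩ := hv
  exact hM.exists_adj_of_proposes hw

theorem IsStableMatching.mul_card_hopeful_le {Δ : ℕ} (hdeg : ∀ v, G.deg v ≤ Δ)
    {M : G.graph.Subgraph} (hM : G.IsStableMatching M) (k : ℕ) :
    k * #(G.hopeful k) ≤ (k + (Δ - 1)) * #(G.matched M) := by
  have h1 := card_le_card (hM.engaged_subset_matched k)
  have h2 := mul_card_rejected_le hdeg k
  calc k * #(G.hopeful k) = k * #(G.engaged k) + k * #(G.rejected k) := by
        rw [card_hopeful, mul_add]
    _ ≤ k * #(G.engaged k) + (Δ - 1) * #(G.engaged k) := by gcongr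
    _ = (k + (Δ - 1)) * #(G.engaged k) := by ring
    _ ≤ _ := by gcongr

theorem IsStableMatching.card_matched {M : G.graph.Subgraph} (hM : G.IsStableMatching M) :
    #(G.matched M) = 2 * M.edgeSet.ncard := by
  classical
  have h := M.spanningCoe.sum_degrees_eq_twice_card_edges
  rw [← SimpleGraph.Subgraph.edgeSet_spanningCoe, ← SimpleGraph.coe_edgeFinset,
    Set.ncard_coe_finset, ← h, matched, card_filter]
  refine sum_congr rfl fun v _ => ?_
  split_ifs with hv
  · obtain ⟨w, hw⟩ := hv
    symm
    rw [← SimpleGraph.card_neighborFinset_eq_degree, card_eq_one]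
    refine ⟨w, ?_⟩
    ext x
    simp only [SimpleGraph.mem_neighborFinset, SimpleGraph.Subgraph.spanningCoe_adj,
      mem_singleton]
    exact ⟨fun h => hM.eq_of_adj h hw, fun h => h ▸ hw⟩
  · symm
    rw [← SimpleGraph.card_neighborFinset_eq_degree, card_eq_zero]
    ext x
    simp only [SimpleGraph.mem_neighborFinset, SimpleGraph.Subgraph.spanningCoe_adj]
    exact ⟨fun h => absurd ⟨x, h⟩ hv, fun h => absurd h (notMem_empty x)⟩

/-- Stability makes `M` maximal, so every neighbour of an unmatched node is matched: the
neighbourhoods of matched nodes cover the graph. -/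
theorem IsStableMatching.card_le_mul_card_matched {Δ : ℕ} (hdeg : ∀ v, G.deg v ≤ Δ)
    (hiso : G.NoIsolated) {M : G.graph.Subgraph} (hM : G.IsStableMatching M) :
    Fintype.card V ≤ Δ * #(G.matched M) := by
  classical
  calc Fintype.card V ≤ #((G.matched M).biUnion fun w => (G.pref w).toFinset) := by
        rw [← card_univ]
        refine card_le_card fun v _ => ?_
        simp only [matched, mem_biUnion, mem_filter, mem_univ, true_and, List.mem_toFinset]
        by_cases hv : ∃ w, M.Adj v w
        · obtain ⟨w, hw⟩ := hv
          exact ⟨w, ⟨v, hw.symm⟩, (G.mem_pref w v).2 hw.symm.adj_sub⟩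
        · obtain ⟨u, hu⟩ := hiso v
          refine ⟨u, ?_, (G.mem_pref u v).2 hu.symm⟩
          by_contra hu'
          push Not at hv hu'
          exact hM.2 v u ⟨hu, hv u, fun w hw => absurd hw (hv w), fun w hw => absurd hw (hu' w)⟩
    _ ≤ #(G.matched M) * Δ := card_biUnion_le_card_mul _ _ _ fun w _ =>
        (List.toFinset_card_le _).trans (hdeg w)
    _ = _ := mul_comm _ _

/-! ### Existence -/

theorem exists_isStableMatching (G : BicolouredGraph V) :
    ∃ M : G.graph.Subgraph, G.IsStableMatching M := by
  classical
  obtain ⟨k, hk⟩ : ∃ k, ∀ v, rivals G.pref (rejections G.pref k) v = [] := by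
    have hdeg : ∀ v, G.deg v ≤ Fintype.card V := fun v => by
      rw [deg, ← List.toFinset_card_of_nodup (G.pref_nodup v)]
      exact card_le_univ _
    -- After `B + 1` rounds, `B + 1` times the number of rejected nodes is at most `B`, so nobody is
    -- rejected any more.
    set B := (Fintype.card V - 1) * Fintype.card V
    refine ⟨B + 1, ?_⟩
    have h1 := mul_card_rejected_le hdeg (B + 1)
    have h2 : (Fintype.card V - 1) * #(G.engaged (B + 1)) ≤ B :=
      Nat.mul_le_mul_left _ (card_le_univ _)
    have h3 : #(G.rejected (B + 1)) = 0 := by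
      by_contra h
      have : B + 1 ≤ (B + 1) * #(G.rejected (B + 1)) :=
        Nat.le_mul_of_pos_right _ (Nat.pos_of_ne_zero h)
      omega
    rw [card_eq_zero] at h3
    intro v
    by_contra hv
    have : v ∈ G.rejected (B + 1) := by simpa [rejected] using hv
    simp [h3] at this
  have hinj : ∀ {u v b}, G.Proposes k u b → G.Proposes k v b → u = v := by
    intro u v b hu hv
    rcases lt_trichotomy ((G.pref b).idxOf u) ((G.pref b).idxOf v) with h | h | h
    · have := hv.mem_rivals_iff.2 ⟨hu, h⟩
      simp [hk] at this
    · exact (List.idxOf_inj (mem_pref_comm.1 hu.mem)).1 h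
    · have := hu.mem_rivals_iff.2 ⟨hv, h⟩
      simp [hk] at this
  -- Only the proposals of red nodes are kept, so that no node is both proposer and recipient. The
  -- colouring is needed in this existence proof alone.
  let R : V → V → Prop := fun u v =>
    (G.isRed u = true ∧ G.Proposes k u v) ∨ (G.isRed v = true ∧ G.Proposes k v u)
  have hRsymm : ∀ {u v}, R u v → R v u := fun h => h.symm
  let M : G.graph.Subgraph :=
    { verts := {v | ∃ w, R v w}
      Adj := R
      adj_sub := fun {u v} h => h.elim (fun h => h.2.adj) (fun h => h.2.adj.symm)
      edge_vert := fun {u v} h => ⟨v, h⟩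
      symm := ⟨fun u v h => hRsymm h⟩ }
  refine ⟨M, ?_, ?_⟩
  · rintro v ⟨w, hw⟩
    refine ⟨w, hw, fun x (hx : R v x) => ?_⟩
    rcases hw with hw | hw <;> rcases hx with hx | hx
    · exact hx.2.eq hw.2
    · exact absurd (hw.1.trans hx.1.symm) (G.isRed_ne _ _ hx.2.adj.symm)
    · exact absurd (hx.1.trans hw.1.symm) (G.isRed_ne _ _ hw.2.adj.symm)
    · exact hinj hx.2 hw.2
  · have key : ∀ u v, G.isRed u = true → ¬ G.Unstable M u v := by
      rintro u v hu ⟨hadj, hM, h1, h2⟩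
      have hv : v ∈ G.pref u := (G.mem_pref u v).2 hadj
      -- Either `u` prefers `v` over its current target or it has exhausted its list; in both cases
      -- `v` has rejected it.
      have hlt : (G.pref u).idxOf v < rejections G.pref k u := by
        by_cases hc : rejections G.pref k u < (G.pref u).length
        · obtain ⟨w, hw⟩ := exists_proposes_of_lt hc
          have := (h1 w (Or.inl ⟨hu, hw⟩)).2.2
          rwa [hw.idxOf_eq] at this
        · exact (List.idxOf_lt_length_of_mem hv).trans_le (not_lt.1 hc)
      obtain ⟨v', hv', hlt'⟩ := exists_proposes_of_idxOf_lt hv hlt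
      have hred : G.isRed v' = true := by
        have e1 := G.isRed_ne _ _ hadj
        have e2 := G.isRed_ne _ _ hv'.adj
        cases h : G.isRed v' <;> cases h' : G.isRed v <;> simp_all
      exact lt_asymm hlt' (h2 v' (Or.inr ⟨hred, hv'⟩)).2.2
    intro u v h
    cases hu : G.isRed u with
    | true => exact key u v hu h
    | false =>
      refine key v u ?_ h.symm
      have := G.isRed_ne _ _ h.1
      cases hv : G.isRed v <;> simp_all

end Counting

end BicolouredGraph

/-! ### The sampling algorithm -/

section Algorithm

open BicolouredGraph (OracleEntry)

/-- The neighbours of the node `v` according to a transcript. -/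
def transcriptNbrs (t : List OracleEntry) (v : ℕ) : List ℕ :=
  t.flatMap fun e => if e.1 = v then e.2.2 else []

/-- The nodes that a transcript shows to be at distance at most `i` from the list `L`. -/
def explored (t : List OracleEntry) (L : List ℕ) : ℕ → List ℕ
  | 0 => L
  | i + 1 => explored t L i ++ (explored t L i).flatMap (transcriptNbrs t)

/-- The nodes in `L` that have not been queried in a transcript. -/
def unqueried (t : List OracleEntry) (L : List ℕ) : List ℕ :=
  L.filterMap fun v => if v ∈ t.map Prod.fst then none else some v

/-- The nodes in `L` that have not been rejected by all their neighbours in `k` rounds. -/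
def hopefulList (k : ℕ) (t : List OracleEntry) (L : List ℕ) : List ℕ :=
  L.filterMap fun v =>
    if rejections (transcriptNbrs t) k v < (transcriptNbrs t v).length then some v else none

/-- The next action of the algorithm that explores the balls of radius `2 * k` around `s` sampled
nodes and computes the fraction of sampled nodes that have not been rejected by all their
neighbours in `k` rounds. -/
def samplingNext (s k : ℕ) (x : ℕ × List ℕ × List OracleEntry) : ℕ ⊕ (ℕ × ℕ) :=
  -- In the empty graph the draws would name a node that does not exist.
  if x.1 = 0 then Sum.inr (0, 1) else
    (unqueried x.2.2 (explored x.2.2 x.2.1 (2 * k))).head?.elim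
      -- The factor 2 is there because each edge of a matching covers two nodes.
      (Sum.inr (x.1 * (hopefulList k x.2.2 x.2.1).length, 2 * s)) Sum.inl

/-! ### Computability of the algorithm -/

open Primrec

theorem primrec_transcriptNbrs : Primrec₂ transcriptNbrs :=
  list_flatMap fst <| ite (Primrec.eq.comp (fst.comp snd) (snd.comp fst))
    (snd.comp (snd.comp snd)) (const [])

theorem primrec_rivals {c : List OracleEntry → ℕ → ℕ} (hc : Primrec₂ c) :
    Primrec₂ fun t v => rivals (transcriptNbrs t) (c t) v := by
  have hprop : Primrec₂ fun (t : List OracleEntry) (v : ℕ) => (transcriptNbrs t v)[c t v]? :=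
    list_getElem?.comp primrec_transcriptNbrs hc
  refine list_flatMap (optionToList.comp hprop) ?_
  have hb : Primrec₂ fun (p : List OracleEntry × ℕ) (b : ℕ) => transcriptNbrs p.1 b :=
    primrec_transcriptNbrs.comp (fst.comp fst) snd
  refine listFilterMap (list_take.comp (list_idxOf.comp (snd.comp fst) hb) hb) ?_
  refine ite (Primrec.eq.comp ?_ ?_) ?_ (const none)
  · exact hprop.comp (fst.comp (fst.comp fst)) snd
  · exact option_some.comp (snd.comp fst)
  · exact option_some.comp snd

/-- As `k` is a constant of the algorithm, the recursion on it can take place outside: each round is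
one more composition. -/
theorem primrec_rejections (k : ℕ) :
    Primrec₂ fun t v => rejections (transcriptNbrs t) k v := by
  induction k with
  | zero => exact const 0
  | succ k ih =>
    exact ite (Primrec.eq.comp (primrec_rivals ih) (const [])) ih (succ.comp ih)

theorem primrec_explored (i : ℕ) : Primrec₂ fun t L => explored t L i := by
  induction i with
  | zero => exact snd
  | succ i ih =>
    exact list_append.comp ih
      (list_flatMap ih (primrec_transcriptNbrs.comp (fst.comp fst) snd))

theorem primrec_unqueried : Primrec₂ unqueried := by
  refine listFilterMap snd (ite ?_ (const none) (option_some.comp snd))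
  refine PrimrecPred.of_eq (p := fun q : (List OracleEntry × List ℕ) × ℕ =>
    (q.1.1.map Prod.fst).idxOf q.2 < (q.1.1.map Prod.fst).length) ?_
    fun q => List.idxOf_lt_length_iff
  have h : Primrec fun q : (List OracleEntry × List ℕ) × ℕ => q.1.1.map Prod.fst :=
    list_map (fst.comp fst) (fst.comp snd)
  exact nat_lt.comp (list_idxOf.comp snd h) (list_length.comp h)

theorem primrec_hopefulList (k : ℕ) : Primrec₂ (hopefulList k) := by
  refine listFilterMap snd (ite (nat_lt.comp ?_ ?_) (option_some.comp snd) (const none))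
  · exact (primrec_rejections k).comp (fst.comp fst) snd
  · exact list_length.comp (primrec_transcriptNbrs.comp (fst.comp fst) snd)

theorem primrec_samplingNext (s k : ℕ) : Primrec (samplingNext s k) := by
  refine ite (Primrec.eq.comp fst (const 0)) (const _) ?_
  refine (option_casesOn
    (list_head?.comp (primrec_unqueried.comp (snd.comp snd)
      ((primrec_explored (2 * k)).comp (snd.comp snd) (fst.comp snd)))) ?_ ?_).of_eq
    (g := fun x => (unqueried x.2.2 (explored x.2.2 x.2.1 (2 * k))).head?.elim
      (Sum.inr (x.1 * (hopefulList k x.2.2 x.2.1).length, 2 * s)) Sum.inl)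
    (fun x => by cases (unqueried x.2.2 (explored x.2.2 x.2.1 (2 * k))).head? <;> rfl)
  · refine sumInr.comp (Primrec.pair (nat_mul.comp fst ?_) (const _))
    exact list_length.comp ((primrec_hopefulList k).comp (snd.comp snd) (fst.comp snd))
  · exact sumInl.comp snd

/-- The algorithm that estimates the size of a stable matching from the truncated
deferred-acceptance dynamics around `s` sampled nodes. -/
def samplingAlgorithm (s k : ℕ) : OracleAlgorithm where
  draws _ := s
  -- This is `n` for positive `n`, and still positive for `n = 0`.
  range n := n.pred + 1
  range_pos _ := Nat.succ_pos _
  next := samplingNext s k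
  draws_computable := (const s).to_comp
  range_computable := (succ.comp pred).to_comp
  next_computable := (primrec_samplingNext s k).to_comp

end Algorithm

namespace BicolouredGraph

/-! ### Locality -/

section Locality

variable {n : ℕ} (G : BicolouredGraph (Fin n))

/-- The function `nb` gives the preference lists of all nodes at distance at most `d` from `v`. -/
def Agrees (nb : ℕ → List ℕ) : ℕ → Fin n → Prop
  | 0, v => nb v = (G.pref v).map Fin.val
  | d + 1, v => Agrees nb d v ∧ ∀ u ∈ G.pref v, Agrees nb d u

variable {G}

theorem Agrees.mono {nb : ℕ → List ℕ} {d e : ℕ} (h : d ≤ e) {v : Fin n} (hv : G.Agrees nb e v) :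
    G.Agrees nb d v := by
  induction h with
  | refl => exact hv
  | step _ ih => exact ih hv.1

theorem Agrees.nbrs_eq {nb : ℕ → List ℕ} {d : ℕ} {v : Fin n} (hv : G.Agrees nb d v) :
    nb v = (G.pref v).map Fin.val :=
  Agrees.mono (Nat.zero_le d) hv

theorem idxOf_map_val (l : List (Fin n)) (v : Fin n) :
    (l.map Fin.val).idxOf v.val = l.idxOf v := by
  induction l with
  | nil => simp
  | cons a l ih =>
    by_cases h : a = v
    · subst h; simp
    · rw [List.map_cons, List.idxOf_cons_ne _ h, List.idxOf_cons_ne _ (Fin.val_ne_of_ne h), ih]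

/-- One round looks two steps away: from `v` to its target `b`, and on to the other proposers of
`b`. -/
theorem Agrees.rejections_eq {nb : ℕ → List ℕ} {k : ℕ} {v : Fin n}
    (hv : G.Agrees nb (2 * k) v) : rejections nb k v.val = rejections G.pref k v := by
  induction k generalizing v with
  | zero => rfl
  | succ k ih =>
    have hv' : G.Agrees nb (2 * k) v := Agrees.mono (by omega) hv
    have hstep : ∀ u ∈ G.pref v, ∀ w ∈ G.pref u, G.Agrees nb (2 * k) w :=
      fun u hu w hw => (hv.2 u hu).2 w hw
    have hprop : ∀ w : Fin n, G.Agrees nb (2 * k) w →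
        (nb w)[rejections nb k w]? = ((G.pref w)[rejections G.pref k w]?).map Fin.val := by
      intro w hw
      rw [ih hw, hw.nbrs_eq, List.getElem?_map]
    have hriv : rivals nb (rejections nb k) v.val = [] ↔
        rivals G.pref (rejections G.pref k) v = [] := by
      rw [List.eq_nil_iff_forall_not_mem, List.eq_nil_iff_forall_not_mem, ← not_exists,
        ← not_exists, not_iff_not]
      constructor
      · rintro ⟨r, hr⟩
        obtain ⟨b, hb, hrb, hmem, hlt⟩ := mem_rivals.1 hr
        rw [hprop v hv', Option.map_eq_some_iff] at hb
        obtain ⟨b, hb, rfl⟩ := hb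
        have hbm : b ∈ G.pref v := List.mem_of_getElem? hb
        rw [(hv.2 b hbm).nbrs_eq] at hmem hlt
        obtain ⟨r, hrm, rfl⟩ := List.mem_map.1 hmem
        rw [hprop r (hstep b hbm r hrm), Option.map_eq_some_iff] at hrb
        obtain ⟨b', hrb, hbb⟩ := hrb
        cases Fin.val_injective hbb
        rw [idxOf_map_val, idxOf_map_val] at hlt
        exact ⟨r, mem_rivals.2 ⟨b, hb, hrb, hrm, hlt⟩⟩
      · rintro ⟨r, hr⟩
        obtain ⟨b, hb, hrb, hmem, hlt⟩ := mem_rivals.1 hr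
        have hbm : b ∈ G.pref v := List.mem_of_getElem? hb
        refine ⟨r, mem_rivals.2 ⟨b, ?_, ?_, ?_, ?_⟩⟩
        · rw [hprop v hv', hb]; rfl
        · rw [hprop r (hstep b hbm r hmem), hrb]; rfl
        · rw [(hv.2 b hbm).nbrs_eq]; exact List.mem_map_of_mem hmem
        · rwa [(hv.2 b hbm).nbrs_eq, idxOf_map_val, idxOf_map_val]
    by_cases h : rivals G.pref (rejections G.pref k) v = []
    · rw [rejections_succ_of_eq_nil h, rejections_succ_of_eq_nil (hriv.2 h), ih hv']
    · rw [rejections_succ_of_ne_nil h, rejections_succ_of_ne_nil (fun h' => h (hriv.1 h')),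
        ih hv']

end Locality

/-! ### Balls -/

section Balls

open Finset

variable {V : Type*} [DecidableEq V] (G : BicolouredGraph V)

/-- The nodes at distance at most `i` from `S`. -/
def ball (S : Finset V) : ℕ → Finset V
  | 0 => S
  | i + 1 => ball S i ∪ (ball S i).biUnion fun v => (G.pref v).toFinset

variable {G}

theorem ball_subset_succ (S : Finset V) (i : ℕ) : G.ball S i ⊆ G.ball S (i + 1) :=
  subset_union_left

theorem mem_ball_succ {S : Finset V} {i : ℕ} {v u : V} (hv : v ∈ G.ball S i)
    (hu : u ∈ G.pref v) : u ∈ G.ball S (i + 1) :=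
  mem_union_right _ (mem_biUnion.2 ⟨v, hv, List.mem_toFinset.2 hu⟩)

/-- Beyond the first step, a node of the outermost sphere has a neighbour further in, so at most `d`
of its neighbours are new. -/
theorem card_ball_succ_sdiff_le {d : ℕ} (hdeg : ∀ v, G.deg v ≤ d + 1) (S : Finset V) (i : ℕ) :
    #(G.ball S (i + 1) \ G.ball S i) ≤ #S * ((d + 1) * d ^ i) := by
  induction i with
  | zero =>
    calc #(G.ball S 1 \ G.ball S 0) ≤ #(S.biUnion fun v => (G.pref v).toFinset) := by
          refine card_le_card fun v hv => ?_
          simp only [ball, mem_sdiff, mem_union] at hv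
          tauto
      _ ≤ #S * (d + 1) := card_biUnion_le_card_mul _ _ _ fun v _ =>
          (List.toFinset_card_le _).trans (hdeg v)
      _ = _ := by simp
  | succ i ih =>
    calc #(G.ball S (i + 2) \ G.ball S (i + 1))
        ≤ #((G.ball S (i + 1) \ G.ball S i).biUnion
            fun v => (G.pref v).toFinset \ G.ball S (i + 1)) := by
          refine card_le_card fun v hv => ?_
          obtain ⟨hv, hv'⟩ := mem_sdiff.1 hv
          rcases mem_union.1 hv with h | h
          · exact absurd h hv'
          · obtain ⟨u, hu, huv⟩ := mem_biUnion.1 h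
            refine mem_biUnion.2 ⟨u, mem_sdiff.2 ⟨hu, fun hu' => hv' ?_⟩,
              mem_sdiff.2 ⟨huv, hv'⟩⟩
            exact mem_ball_succ hu' (List.mem_toFinset.1 huv)
      _ ≤ #(G.ball S (i + 1) \ G.ball S i) * d := by
          refine card_biUnion_le_card_mul _ _ _ fun v hv => ?_
          obtain ⟨hv, hv'⟩ := mem_sdiff.1 hv
          rcases mem_union.1 hv with h | h
          · exact absurd h hv'
          · obtain ⟨u, hu, huv⟩ := mem_biUnion.1 h
            have huv' : u ∈ (G.pref v).toFinset :=
              List.mem_toFinset.2 (mem_pref_comm.1 (List.mem_toFinset.1 huv))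
            calc #((G.pref v).toFinset \ G.ball S (i + 1)) ≤ #((G.pref v).toFinset.erase u) := by
                  refine card_le_card fun w hw => ?_
                  obtain ⟨hw, hw'⟩ := mem_sdiff.1 hw
                  exact mem_erase.2 ⟨fun h => hw' (h ▸ ball_subset_succ _ _ hu), hw⟩
              _ ≤ d := by
                  rw [card_erase_of_mem huv', List.toFinset_card_of_nodup (G.pref_nodup v)]
                  have := hdeg v
                  rw [deg] at this
                  omega
      _ ≤ #S * ((d + 1) * d ^ i) * d := by gcongr
      _ = _ := by ring

theorem card_ball_le {d : ℕ} (hd : 2 ≤ d) (hdeg : ∀ v, G.deg v ≤ d + 1) (S : Finset V) (i : ℕ) :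
    #(G.ball S i) ≤ #S * (3 * d ^ i) := by
  -- The extra `2 * #S` makes the start of the induction an equality; the induction step needs `d +
  -- 4 ≤ 3 * d`, that is, `2 ≤ d`.
  suffices h : #(G.ball S i) + 2 * #S ≤ #S * (3 * d ^ i) by omega
  induction i with
  | zero => simp [ball]; omega
  | succ i ih =>
    have h1 := card_ball_succ_sdiff_le hdeg S i
    rw [card_sdiff_of_subset (ball_subset_succ S i)] at h1
    have h2 := card_le_card (G.ball_subset_succ S i)
    calc #(G.ball S (i + 1)) + 2 * #S ≤ #S * ((d + 1) * d ^ i) + #S * (3 * d ^ i) := by omega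
      _ = #S * ((d + 4) * d ^ i) := by ring
      _ ≤ #S * ((3 * d) * d ^ i) := by gcongr; omega
      _ = _ := by ring

end Balls

/-! ### Runs of the algorithm -/

section Runs

open Finset

variable {n : ℕ} {G : BicolouredGraph (Fin n)}

theorem mem_transcriptNbrs {vs : List (Fin n)} {u : Fin n} {x : ℕ}
    (h : x ∈ transcriptNbrs (vs.map G.reply) u.val) : ∃ w ∈ G.pref u, w.val = x := by
  simp only [transcriptNbrs, List.mem_flatMap, List.mem_map] at h
  obtain ⟨_, ⟨u', -, rfl⟩, h⟩ := h
  split_ifs at h with hu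
  · cases Fin.val_injective hu
    exact List.mem_map.1 h
  · simp at h

/-- All replies about `u` get concatenated, so querying a node twice would duplicate its list; hence
`Nodup`. -/
theorem transcriptNbrs_eq {vs : List (Fin n)} (hvs : vs.Nodup) {u : Fin n} (hu : u ∈ vs) :
    transcriptNbrs (vs.map G.reply) u.val = (G.pref u).map Fin.val := by
  have hnil : ∀ vs : List (Fin n), u ∉ vs → transcriptNbrs (vs.map G.reply) u.val = [] := by
    intro vs h
    simp only [transcriptNbrs, List.flatMap_eq_nil_iff, List.mem_map]
    rintro _ ⟨w, hw, rfl⟩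
    exact if_neg fun e => h ((Fin.val_injective e : w = u) ▸ hw)
  induction vs with
  | nil => simp at hu
  | cons a vs ih =>
    have hcons : transcriptNbrs ((a :: vs).map G.reply) u.val =
        (if a.val = u.val then (G.pref a).map Fin.val else []) ++
          transcriptNbrs (vs.map G.reply) u.val := rfl
    rw [hcons]
    by_cases h : a = u
    · subst h
      rw [hnil vs (List.nodup_cons.1 hvs).1]; simp
    · rw [if_neg (Fin.val_ne_of_ne h), List.nil_append]
      exact ih (List.nodup_cons.1 hvs).2 ((List.mem_cons.1 hu).resolve_left (Ne.symm h))

theorem exists_mem_ball_of_mem_explored {vs : List (Fin n)} {S : Finset (Fin n)} {L : List ℕ}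
    (hL : ∀ x ∈ L, ∃ u ∈ S, u.val = x) {i x : ℕ}
    (hx : x ∈ explored (vs.map G.reply) L i) : ∃ u ∈ G.ball S i, u.val = x := by
  induction i generalizing x with
  | zero => exact hL x hx
  | succ i ih =>
    rcases List.mem_append.1 hx with h | h
    · obtain ⟨u, hu, rfl⟩ := ih h
      exact ⟨u, ball_subset_succ _ _ hu, rfl⟩
    · obtain ⟨y, hy, hyx⟩ := List.mem_flatMap.1 h
      obtain ⟨u, hu, rfl⟩ := ih hy
      obtain ⟨w, hw, rfl⟩ := mem_transcriptNbrs hyx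
      exact ⟨w, mem_ball_succ hu hw, rfl⟩

theorem explored_subset {t : List OracleEntry} {L : List ℕ} {i j : ℕ} (h : i ≤ j) :
    explored t L i ⊆ explored t L j := by
  induction h with
  | refl => exact fun _ h => h
  | step _ ih => exact fun x hx => List.mem_append_left _ (ih hx)

theorem agrees_of_mem_explored {vs : List (Fin n)} (hvs : vs.Nodup) {L : List ℕ} {ρ : ℕ}
    (hdone : ∀ v : Fin n, v.val ∈ explored (vs.map G.reply) L ρ → v ∈ vs) {d : ℕ} (hd : d ≤ ρ)
    {v : Fin n} (hv : v.val ∈ explored (vs.map G.reply) L (ρ - d)) :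
    G.Agrees (transcriptNbrs (vs.map G.reply)) d v := by
  induction d generalizing v with
  | zero => exact transcriptNbrs_eq hvs (hdone v hv)
  | succ d ih =>
    have e : ρ - d = (ρ - (d + 1)) + 1 := by omega
    refine ⟨ih (by omega) (explored_subset (by omega) hv), fun u hu => ih (by omega) ?_⟩
    rw [e]
    refine List.mem_append_right _ (List.mem_flatMap.2 ⟨v, hv, ?_⟩)
    rw [transcriptNbrs_eq hvs (hdone v (explored_subset (by omega) hv))]
    exact List.mem_map_of_mem hu

theorem mem_unqueried {vs : List (Fin n)} {L : List ℕ} {v : Fin n} :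
    v.val ∈ unqueried (vs.map G.reply) L ↔ v.val ∈ L ∧ v ∉ vs := by
  have : v.val ∈ (vs.map G.reply).map Prod.fst ↔ v ∈ vs := by
    rw [List.map_map, List.mem_map]
    exact ⟨fun ⟨u, hu, h⟩ => Fin.val_injective h ▸ hu, fun h => ⟨v, h, rfl⟩⟩
  simp only [unqueried, List.mem_filterMap]
  constructor
  · rintro ⟨a, ha, h⟩
    split_ifs at h with h'
    cases h
    exact ⟨ha, fun hv => h' (this.2 hv)⟩
  · rintro ⟨h1, h2⟩
    exact ⟨v, h1, if_neg fun h => h2 (this.1 h)⟩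

theorem length_hopefulList {s k : ℕ} {t : List OracleEntry} (ω : Fin s → Fin n)
    (h : ∀ i, G.Agrees (transcriptNbrs t) (2 * k) (ω i)) :
    (hopefulList k t (List.ofFn fun i => (ω i).val)).length = #{i | ω i ∈ G.hopeful k} := by
  classical
  have hp : ∀ i, rejections (transcriptNbrs t) k (ω i).val < (transcriptNbrs t (ω i).val).length ↔
      ω i ∈ G.hopeful k := by
    intro i
    rw [(h i).rejections_eq, (h i).nbrs_eq, List.length_map]
    simp [hopeful]
  have e : hopefulList k t (List.ofFn fun i => (ω i).val) =
      ((List.finRange s).filter fun i => ω i ∈ G.hopeful k).map fun i => (ω i).val := by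
    rw [hopefulList, List.ofFn_eq_map, List.filterMap_map, ← List.filterMap_eq_map,
      ← List.filterMap_eq_filter, List.filterMap_filterMap]
    refine List.filterMap_congr fun i _ => ?_
    by_cases hi : ω i ∈ G.hopeful k
    · simp [(hp i).2 hi, hi, Option.guard]
    · have := mt (hp i).1 hi
      simp [hi, Option.guard]
      omega
  rw [e, List.length_map,
    ← List.toFinset_card_of_nodup ((List.nodup_finRange s).sublist List.filter_sublist)]
  congr 1
  ext i
  simp

theorem exists_run {s k m : ℕ} (hs : 0 < s) (G : BicolouredGraph (Fin (m + 1)))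
    (ω : Fin s → Fin (m + 1)) :
    ∃ q, q ≤ #(G.ball (univ.image ω) (2 * k)) ∧
      (samplingAlgorithm s k).Run G ω [] q
        (((m + 1) * #{i | ω i ∈ G.hopeful k} : ℕ) / (2 * s : ℕ)) := by
  classical
  set W := G.ball (univ.image ω) (2 * k)
  set L : List ℕ := List.ofFn fun i => (ω i).val
  have hL : ∀ x ∈ L, ∃ u ∈ univ.image ω, u.val = x := by
    intro x hx
    obtain ⟨i, rfl⟩ := (List.mem_ofFn' _ _).1 hx
    exact ⟨ω i, mem_image_of_mem _ (mem_univ i), rfl⟩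
  -- Every query goes to a new node of `W`; `r` is fuel that cannot run out, as `vs` would then have
  -- more than `#W` entries.
  suffices key : ∀ (r : ℕ) (vs : List (Fin (m + 1))), vs.Nodup → vs.toFinset ⊆ W →
      #W < vs.length + r → ∃ q, q + vs.length ≤ #W ∧
        (samplingAlgorithm s k).Run G ω (vs.map G.reply) q
          (((m + 1) * #{i | ω i ∈ G.hopeful k} : ℕ) / (2 * s : ℕ)) by
    simpa using key (#W + 1) [] List.nodup_nil (by simp) (by simp)
  intro r
  induction r with
  | zero =>
    intro vs hvs hsub hlt
    have := card_le_card hsub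
    rw [List.toFinset_card_of_nodup hvs] at this
    omega
  | succ r ih =>
    intro vs hvs hsub hlt
    have hnext : (samplingAlgorithm s k).next (m + 1, L, vs.map G.reply) =
        (unqueried (vs.map G.reply) (explored (vs.map G.reply) L (2 * k))).head?.elim
          (Sum.inr ((m + 1) * (hopefulList k (vs.map G.reply) L).length, 2 * s)) Sum.inl := by
      simp [samplingAlgorithm, samplingNext]
    rcases hq : (unqueried (vs.map G.reply) (explored (vs.map G.reply) L (2 * k))).head? with _ | x
    · rw [hq] at hnext
      rw [List.head?_eq_none_iff] at hq
      have hdone : ∀ v : Fin (m + 1), v.val ∈ explored (vs.map G.reply) L (2 * k) → v ∈ vs := by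
        intro v hv
        by_contra h
        have := (mem_unqueried (G := G)).2 ⟨hv, h⟩
        simp [hq] at this
      have hagree : ∀ i, G.Agrees (transcriptNbrs (vs.map G.reply)) (2 * k) (ω i) := by
        intro i
        refine agrees_of_mem_explored hvs hdone le_rfl ?_
        rw [Nat.sub_self]
        exact (List.mem_ofFn' _ _).2 ⟨i, rfl⟩
      refine ⟨0, ?_, OracleAlgorithm.Run.output _ _ (by omega) ?_⟩
      · have := card_le_card hsub
        rw [List.toFinset_card_of_nodup hvs] at this
        omega
      · rw [← length_hopefulList ω hagree]
        exact hnext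
    · rw [hq] at hnext
      have hx := List.mem_of_mem_head? hq
      have hx' : x ∈ explored (vs.map G.reply) L (2 * k) := by
        simp only [unqueried, List.mem_filterMap] at hx
        obtain ⟨a, ha, h⟩ := hx
        split_ifs at h
        cases h
        exact ha
      obtain ⟨v, hv, rfl⟩ := exists_mem_ball_of_mem_explored hL hx'
      have hvs' : v ∉ vs := (mem_unqueried.1 hx).2
      obtain ⟨q, hq1, hq2⟩ := ih (vs ++ [v])
        (List.nodup_append.2 ⟨hvs, List.nodup_singleton v, by
          rintro a ha b hb rfl; exact hvs' (List.mem_singleton.1 hb ▸ ha)⟩)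
        (by
          intro w hw
          rcases List.mem_append.1 (List.mem_toFinset.1 hw) with h | h
          · exact hsub (List.mem_toFinset.2 h)
          · exact List.mem_singleton.1 h ▸ hv)
        (by rw [List.length_append, List.length_singleton]; omega)
      rw [List.length_append, List.length_singleton] at hq1
      rw [List.map_append] at hq2
      exact ⟨q + 1, by omega, OracleAlgorithm.Run.query v hnext hq2⟩

end Runs

end BicolouredGraph

/-! ### Concentration -/

section Concentration

open Finset

/-- The exponential moment method for a sum of independent copies of a centred variable with
values in `[-1, 1]`. -/
theorem card_filter_le_sum_le {α : Type*} [Fintype α] (f : α → ℝ)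
    (hf : ∀ a, |f a| ≤ 1) (hsum : ∑ a, f a = 0) (s : ℕ) {τ : ℝ} (hτ : 0 ≤ τ) (hτ' : τ ≤ 1) :
    (#{ω : Fin s → α | s * τ ≤ ∑ i, f (ω i)} : ℝ) ≤
      Real.exp (-(s * τ ^ 2 / 4)) * (Fintype.card α : ℝ) ^ s := by
  classical
  -- This minimises the exponent `s * (l ^ 2 - l * τ)`, with minimum `-(s * τ ^ 2 / 4)`.
  set l := τ / 2 with hl
  have hmgf : ∑ a, Real.exp (l * f a) ≤ Fintype.card α * Real.exp (l ^ 2) := by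
    calc ∑ a, Real.exp (l * f a) ≤ ∑ a, (1 + l * f a + l ^ 2) := by
          refine sum_le_sum fun a _ => ?_
          have h1 : |l * f a| ≤ l := by
            rw [abs_mul, abs_of_nonneg (by positivity)]
            exact mul_le_of_le_one_right (by positivity) (hf a)
          -- This gives `exp x ≤ 1 + x + x ^ 2` for `|x| ≤ 1`; the linear term vanishes on
          -- summation.
          have h2 := Real.abs_exp_sub_one_sub_id_le (h1.trans (by linarith))
          have h3 : (l * f a) ^ 2 ≤ l ^ 2 := by
            rw [← sq_abs]; gcongr
          have := (abs_le.1 h2).2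
          linarith
      _ = Fintype.card α * (1 + l ^ 2) := by
          rw [sum_add_distrib, sum_add_distrib, ← mul_sum, hsum]
          simp
          ring
      _ ≤ _ := by
          gcongr
          linarith [Real.add_one_le_exp (l ^ 2)]
  have hmarkov : (#{ω : Fin s → α | s * τ ≤ ∑ i, f (ω i)} : ℝ) * Real.exp (l * (s * τ)) ≤
      ∑ ω : Fin s → α, ∏ i, Real.exp (l * f (ω i)) := by
    rw [← nsmul_eq_mul, ← sum_const]
    calc _ ≤ ∑ ω ∈ ({ω : Fin s → α | s * τ ≤ ∑ i, f (ω i)} : Finset _),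
          ∏ i, Real.exp (l * f (ω i)) := by
          refine sum_le_sum fun ω hω => ?_
          rw [← Real.exp_sum, ← mul_sum]
          exact Real.exp_le_exp.2 (mul_le_mul_of_nonneg_left (mem_filter.1 hω).2 (by positivity))
      _ ≤ _ := sum_le_univ_sum_of_nonneg fun ω => by positivity
  have hprod : ∑ ω : Fin s → α, ∏ i, Real.exp (l * f (ω i)) = (∑ a, Real.exp (l * f a)) ^ s := by
    rw [Fintype.sum_pow]
  have h := hmarkov.trans (hprod.le.trans
    (pow_le_pow_left₀ (by positivity) hmgf s))
  rw [mul_pow, ← Real.exp_nat_mul, ← le_div_iff₀ (by positivity), mul_div_assoc,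
    ← Real.exp_sub] at h
  refine h.trans (le_of_eq ?_)
  rw [mul_comm]
  congr 2
  rw [hl]
  ring

theorem card_filter_le_abs_sum_le {α : Type*} [Fintype α] (f : α → ℝ)
    (hf : ∀ a, |f a| ≤ 1) (hsum : ∑ a, f a = 0) (s : ℕ) {τ : ℝ} (hτ : 0 ≤ τ) (hτ' : τ ≤ 1) :
    (#{ω : Fin s → α | s * τ ≤ |∑ i, f (ω i)|} : ℝ) ≤
      2 * Real.exp (-(s * τ ^ 2 / 4)) * (Fintype.card α : ℝ) ^ s := by
  classical
  have h1 := card_filter_le_sum_le f hf hsum s hτ hτ'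
  have h2 := card_filter_le_sum_le (fun a => - f a) (by simpa using hf) (by simpa using hsum) s
    hτ hτ'
  have h3 : (#{ω : Fin s → α | s * τ ≤ |∑ i, f (ω i)|} : ℝ) ≤
      #{ω : Fin s → α | s * τ ≤ ∑ i, f (ω i)} +
        #{ω : Fin s → α | s * τ ≤ ∑ i, - f (ω i)} := by
    rw [← Nat.cast_add]
    refine Nat.cast_le.2 ((card_le_card fun ω hω => ?_).trans (card_union_le _ _))
    simp only [mem_filter, mem_univ, true_and, mem_union, sum_neg_distrib] at hω ⊢
    exact le_abs.1 hω
  linarith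

/-- Estimating the density of a set of nodes from uniform samples. -/
theorem one_sub_le_card_abs_sub_lt {α : Type*} [Fintype α] [Nonempty α] (U : Finset α) {s : ℕ}
    {τ δ : ℝ} (hτ : 0 < τ) (hτ' : τ ≤ 1) (hδ : 0 < δ)
    (hs : 4 * Real.log (2 / δ) ≤ s * τ ^ 2) [DecidableEq α] :
    (1 - δ) * (Fintype.card α : ℝ) ^ s ≤
      #{ω : Fin s → α | |(#{i | ω i ∈ U} : ℝ) - s * (#U / Fintype.card α)| < s * τ} := by
  classical
  have hcard : (0 : ℝ) < Fintype.card α := by exact_mod_cast Fintype.card_pos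
  set p : ℝ := #U / Fintype.card α with hp
  have hp0 : 0 ≤ p := by positivity
  have hp1 : p ≤ 1 := by
    rw [hp, div_le_one hcard]; exact_mod_cast card_le_univ U
  let f : α → ℝ := fun a => (if a ∈ U then 1 else 0) - p
  have hf : ∀ a, |f a| ≤ 1 := by
    intro a
    simp only [f]
    split_ifs <;> rw [abs_le] <;> constructor <;> linarith
  have hsum : ∑ a, f a = 0 := by
    simp only [f, sum_sub_distrib, sum_boole, sum_const, card_univ, nsmul_eq_mul, hp]
    rw [mul_div_cancel₀ _ hcard.ne']
    simp
  have hfs : ∀ ω : Fin s → α, ∑ i, f (ω i) = (#{i | ω i ∈ U} : ℝ) - s * p := by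
    intro ω
    simp [f, sum_sub_distrib]
  have h := card_filter_le_abs_sum_le f hf hsum s hτ.le hτ'
  have hexp : 2 * Real.exp (-(s * τ ^ 2 / 4)) ≤ δ := by
    have : Real.exp (-(s * τ ^ 2 / 4)) ≤ Real.exp (-Real.log (2 / δ)) :=
      Real.exp_le_exp.2 (by linarith)
    rw [Real.exp_neg (Real.log _), Real.exp_log (by positivity), inv_div] at this
    linarith
  have htot : (#{ω : Fin s → α | |(#{i | ω i ∈ U} : ℝ) - s * p| < s * τ} : ℝ) +
      #{ω : Fin s → α | s * τ ≤ |∑ i, f (ω i)|} = (Fintype.card α : ℝ) ^ s := by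
    have := card_filter_add_card_filter_not (s := (univ : Finset (Fin s → α)))
      (fun ω => |(#{i | ω i ∈ U} : ℝ) - s * p| < s * τ)
    simp only [not_lt, card_univ, Fintype.card_fun, Fintype.card_fin] at this
    simp only [hfs]
    exact_mod_cast this
  have : 2 * Real.exp (-(s * τ ^ 2 / 4)) * (Fintype.card α : ℝ) ^ s ≤
      δ * (Fintype.card α : ℝ) ^ s := by gcongr
  linarith

end Concentration

/-! ### Constants and the final estimate -/

section Main

open Finset

theorem OracleAlgorithm.le_prob (A : OracleAlgorithm) {n : ℕ} {P Q : A.Seed n → Prop}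
    [DecidablePred Q] (hPQ : ∀ ω, Q ω → P ω) {c : ℝ}
    (h : c * (Nat.card (A.Seed n) : ℝ) ≤ #{ω | Q ω}) : c ≤ A.prob n P := by
  have : Nonempty (Fin (A.range n)) := ⟨⟨0, A.range_pos n⟩⟩
  rw [OracleAlgorithm.prob, le_div_iff₀ (by exact_mod_cast Nat.card_pos)]
  refine h.trans (Nat.cast_le.2 ?_)
  rw [← Fintype.card_subtype, ← Nat.card_eq_fintype_card]
  exact Nat.card_le_card_of_injective (fun x => (⟨x.1, hPQ _ x.2⟩ : {ω // P ω}))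
    fun x y hxy => Subtype.ext (congrArg (fun z : {ω // P ω} => z.1) hxy)

theorem run_samplingAlgorithm_zero (s k : ℕ) (G : BicolouredGraph (Fin 0))
    (ω : (samplingAlgorithm s k).Seed 0) : (samplingAlgorithm s k).Run G ω [] 0 0 := by
  have h : (samplingAlgorithm s k).Run G ω [] 0 (((0 : ℕ) : ℝ) / ((1 : ℕ) : ℝ)) :=
    .output 0 1 one_ne_zero (by simp [samplingAlgorithm, samplingNext])
  simpa using h

/-- With `d = Δ - 1`, the bounds `Δ ≤ 3 / 2 * d` and `log (2 / δ) ≤ 2 * log (1 / δ)` give the factor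
`16 * 9 / 4 * 2 = 72`; rounding up adds 1. The resulting `3 * 73 = 219` is far below 25000. -/
theorem query_bound {δ ε : ℝ} {Δ : ℕ} (hδ : 0 < δ) (hδ' : δ ≤ 1 / 2) (hε : 0 < ε) (hε' : ε ≤ 1)
    (hΔ : 3 ≤ Δ) :
    (⌈16 * (Δ : ℝ) ^ 2 * Real.log (2 / δ) / ε ^ 2⌉₊ : ℝ) *
        (3 * ((Δ : ℝ) - 1) ^ (2 * ⌈2 * ((Δ : ℝ) - 1) / ε⌉₊)) ≤
      25000 * (1 / ε ^ 2) * ((Δ : ℝ) - 1) ^ (3 + 4 * (Δ : ℝ) / ε) * Real.log (1 / δ) := by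
  have hΔ' : (3 : ℝ) ≤ Δ := by exact_mod_cast hΔ
  obtain ⟨d, hd⟩ : ∃ d : ℝ, d = Δ - 1 := ⟨_, rfl⟩
  rw [← hd]
  have hd2 : 2 ≤ d := by linarith
  set l := Real.log (1 / δ) with hl
  have hl2 : Real.log 2 ≤ l := by
    refine Real.log_le_log two_pos ?_
    rw [le_div_iff₀ hδ]; linarith
  have hlog2 := Real.log_two_gt_d9
  have hlδ : Real.log (2 / δ) ≤ 2 * l := by
    have : (2 : ℝ) / δ = 2 * (1 / δ) := by ring
    rw [this, Real.log_mul two_ne_zero (by positivity)]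
    linarith
  have hε2 : ε ^ 2 ≤ 1 := pow_le_one₀ hε.le hε'
  have hlog0 : 0 ≤ Real.log (2 / δ) := Real.log_nonneg (by rw [le_div_iff₀ hδ]; linarith)
  have hs : (⌈16 * (Δ : ℝ) ^ 2 * Real.log (2 / δ) / ε ^ 2⌉₊ : ℝ) ≤ 73 * d ^ 2 * l / ε ^ 2 := by
    have h1 : (Δ : ℝ) ^ 2 ≤ 9 / 4 * d ^ 2 := by nlinarith
    have h2 : 16 * (Δ : ℝ) ^ 2 * Real.log (2 / δ) ≤ 72 * d ^ 2 * l := by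
      calc 16 * (Δ : ℝ) ^ 2 * Real.log (2 / δ) ≤ 16 * (9 / 4 * d ^ 2) * (2 * l) := by gcongr
        _ = _ := by ring
    have h3 : 1 ≤ d ^ 2 * l / ε ^ 2 := by
      rw [le_div_iff₀ (by positivity)]
      nlinarith
    calc (⌈16 * (Δ : ℝ) ^ 2 * Real.log (2 / δ) / ε ^ 2⌉₊ : ℝ)
        ≤ 16 * (Δ : ℝ) ^ 2 * Real.log (2 / δ) / ε ^ 2 + 1 :=
          (Nat.ceil_lt_add_one (by positivity)).le
      _ ≤ 72 * d ^ 2 * l / ε ^ 2 + d ^ 2 * l / ε ^ 2 := by gcongr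
      _ = _ := by ring
  have hpow : d ^ (2 * ⌈2 * d / ε⌉₊) ≤ d ^ (1 + 4 * (Δ : ℝ) / ε) := by
    rw [← Real.rpow_natCast]
    refine Real.rpow_le_rpow_of_exponent_le (by linarith) ?_
    have h1 := (Nat.ceil_lt_add_one (a := 2 * d / ε) (by positivity)).le
    -- Having `Δ` instead of `d` in the exponent leaves `4 / ε` to absorb the rounding of `k`.
    have h2 : 4 * (Δ : ℝ) / ε = 2 * (2 * d / ε) + 4 / ε := by rw [hd]; ring
    have h3 : 4 ≤ 4 / ε := by rw [le_div_iff₀ hε]; linarith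
    push_cast
    linarith
  have hsplit : d ^ (3 + 4 * (Δ : ℝ) / ε) = d ^ 2 * d ^ (1 + 4 * (Δ : ℝ) / ε) := by
    rw [← Real.rpow_natCast d 2, ← Real.rpow_add (by linarith)]
    congr 1
    push_cast
    ring
  rw [hsplit]
  have hl0 : 0 ≤ l := by linarith
  calc _ ≤ 73 * d ^ 2 * l / ε ^ 2 * (3 * d ^ (1 + 4 * (Δ : ℝ) / ε)) := by gcongr
    _ = 219 * (d ^ 2 * l / ε ^ 2 * d ^ (1 + 4 * (Δ : ℝ) / ε)) := by ring
    _ ≤ 25000 * (d ^ 2 * l / ε ^ 2 * d ^ (1 + 4 * (Δ : ℝ) / ε)) := by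
        gcongr
        norm_num
    _ = _ := by ring

/-- Here `u` counts hopeful nodes, `c` hopeful samples and `e` the edges of `M`. Truncation (`h5`)
and sampling (`h6`) each cost at most `ε / 2 * e`. -/
theorem abs_estimate_sub_le {ε : ℝ} {Δ k s c u n e : ℕ} (hε : 0 < ε) (hΔ : 3 ≤ Δ)
    (hs : 0 < s) (hn : 0 < n) (hk : 2 * ((Δ : ℝ) - 1) / ε ≤ k) (hu : 2 * e ≤ u)
    (hu' : k * u ≤ (k + (Δ - 1)) * (2 * e)) (hne : n ≤ Δ * (2 * e))
    (hc : |(c : ℝ) - s * (u / n)| < s * (ε / (2 * Δ))) :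
    |((n * c : ℕ) : ℝ) / (2 * s : ℕ) - e| ≤ ε * e := by
  have hΔ' : (3 : ℝ) ≤ Δ := by exact_mod_cast hΔ
  have hs' : (0 : ℝ) < s := by exact_mod_cast hs
  have hn' : (0 : ℝ) < n := by exact_mod_cast hn
  have hk0 : (0 : ℝ) < k := lt_of_lt_of_le (by apply div_pos <;> linarith) hk
  have h1 : (2 : ℝ) * e ≤ u := by exact_mod_cast hu
  have h2 : (k : ℝ) * u ≤ (k + (Δ - 1)) * (2 * e) := by
    have := (Nat.cast_le (α := ℝ)).2 hu'
    push_cast [Nat.cast_sub (show 1 ≤ Δ by omega)] at this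
    linarith
  have h3 : (n : ℝ) ≤ Δ * (2 * e) := by exact_mod_cast hne
  have h4 : (Δ : ℝ) - 1 ≤ k * (ε / 2) := by
    rw [div_le_iff₀ hε] at hk; linarith
  have h5 : (u : ℝ) / 2 ≤ e + ε / 2 * e := by
    have : (k : ℝ) * u ≤ k * (2 * e + ε * e) := by
      calc (k : ℝ) * u ≤ (k + (Δ - 1)) * (2 * e) := h2
        _ ≤ (k + k * (ε / 2)) * (2 * e) := by gcongr
        _ = _ := by ring
    have := le_of_mul_le_mul_left this hk0
    linarith
  have h6 : |((n * c : ℕ) : ℝ) / (2 * s : ℕ) - u / 2| ≤ ε / 2 * e := by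
    have e1 : ((n * c : ℕ) : ℝ) / (2 * s : ℕ) - u / 2 =
        n / (2 * s) * ((c : ℝ) - s * (u / n)) := by
      push_cast
      field_simp
    rw [e1, abs_mul, abs_of_pos (by positivity)]
    calc (n : ℝ) / (2 * s) * |(c : ℝ) - s * (u / n)| ≤ n / (2 * s) * (s * (ε / (2 * Δ))) := by
          gcongr
      _ = n * (ε / (4 * Δ)) := by field_simp; ring
      _ ≤ Δ * (2 * e) * (ε / (4 * Δ)) := by gcongr
      _ = _ := by field_simp; ring
  rw [abs_le] at h6 ⊢
  constructor <;> linarith [h6.1, h6.2]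

end Main

open Finset in
theorem theorem3 (δ ε : ℝ) (Δ : ℕ) (hδ : 0 < δ) (hδ' : δ ≤ 1 / 2) (hε : 0 < ε) (hε' : ε ≤ 1)
    (hΔ : 3 ≤ Δ) :
    ∃ A : OracleAlgorithm, ∀ (n : ℕ) (G : BicolouredGraph (Fin n)),
      G.NoIsolated → (∀ v, G.deg v ≤ Δ) →
      (∀ ω : A.Seed n, ∃ (q : ℕ) (m : ℝ), A.Run G ω [] q m ∧
        (q : ℝ) ≤ 25000 * (1 / ε ^ 2) * ((Δ : ℝ) - 1) ^ (3 + 4 * (Δ : ℝ) / ε) * Real.log (1 / δ)) ∧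
      (∃ M : G.graph.Subgraph, G.IsStableMatching M) ∧
      (∀ M : G.graph.Subgraph, G.IsStableMatching M →
        1 - δ ≤ A.prob n (fun ω => ∃ (q : ℕ) (m : ℝ), A.Run G ω [] q m ∧
          |m - (M.edgeSet.ncard : ℝ)| ≤ ε * (M.edgeSet.ncard : ℝ))) := by
  classical
  have hΔ' : (3 : ℝ) ≤ Δ := by exact_mod_cast hΔ
  have hlog : 0 < Real.log (2 / δ) := Real.log_pos (by rw [lt_div_iff₀ hδ]; linarith)
  have hbound := query_bound hδ hδ' hε hε' hΔ
  -- This is `4 * log (2 / δ) / τ ^ 2`, rounded up, for the density error `τ = ε / (2 * Δ)`.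
  set s := ⌈16 * (Δ : ℝ) ^ 2 * Real.log (2 / δ) / ε ^ 2⌉₊ with hs
  -- Chosen so that `(Δ - 1) / k ≤ ε / 2`.
  set k := ⌈2 * ((Δ : ℝ) - 1) / ε⌉₊ with hk
  have hs0 : 0 < s := Nat.ceil_pos.2 (by positivity)
  have hd0 : (0 : ℝ) ≤ (Δ : ℝ) - 1 := by linarith
  refine ⟨samplingAlgorithm s k, fun n G hiso hdeg => ⟨fun ω => ?_, G.exists_isStableMatching,
    fun M hM => ?_⟩⟩
  · rcases n with _ | m
    · refine ⟨0, 0, run_samplingAlgorithm_zero s k G ω, ?_⟩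
      have : 0 ≤ Real.log (1 / δ) := Real.log_nonneg (by rw [le_div_iff₀ hδ]; linarith)
      push_cast
      positivity
    · obtain ⟨q, hq, hrun⟩ := BicolouredGraph.exists_run hs0 G (k := k) ω
      refine ⟨q, _, hrun, le_trans ?_ hbound⟩
      have h1 := BicolouredGraph.card_ball_le (d := Δ - 1) (by omega)
        (fun v => (hdeg v).trans (by omega)) (univ.image (ω : Fin s → Fin (m + 1))) (2 * k)
      have h2 : #(univ.image (ω : Fin s → Fin (m + 1))) ≤ s :=
        card_image_le.trans (card_fin s).le
      have h3 : q ≤ s * (3 * (Δ - 1) ^ (2 * k)) := (hq.trans h1).trans (Nat.mul_le_mul_right _ h2)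
      have h4 := (Nat.cast_le (α := ℝ)).2 h3
      push_cast [Nat.cast_sub (show 1 ≤ Δ by omega)] at h4
      exact h4
  · rcases n with _ | m
    · have hM0 : M.edgeSet.ncard = 0 := by
        rw [Set.eq_empty_of_isEmpty M.edgeSet, Set.ncard_empty]
      refine OracleAlgorithm.le_prob _ (Q := fun _ => True)
        (fun ω _ => ⟨0, 0, run_samplingAlgorithm_zero s k G ω, by simp [hM0]⟩) ?_
      rw [filter_true, card_univ, ← Nat.card_eq_fintype_card]
      exact mul_le_of_le_one_left (Nat.cast_nonneg _) (by linarith)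
    · have hmain := one_sub_le_card_abs_sub_lt (α := Fin (m + 1)) (G.hopeful k) (s := s)
        (τ := ε / (2 * Δ)) (δ := δ) (by positivity)
        (by rw [div_le_one (by positivity)]; linarith) hδ (by
          have h := Nat.le_ceil (16 * (Δ : ℝ) ^ 2 * Real.log (2 / δ) / ε ^ 2)
          rw [← hs, div_le_iff₀ (by positivity)] at h
          rw [div_pow, ← mul_div_assoc, le_div_iff₀ (by positivity)]
          linarith)
      refine OracleAlgorithm.le_prob (samplingAlgorithm s k) (n := m + 1)
        (Q := fun ω : Fin s → Fin (m + 1) => |(#{i | ω i ∈ G.hopeful k} : ℝ) -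
          s * (#(G.hopeful k) / Fintype.card (Fin (m + 1)))| < s * (ε / (2 * Δ)))
        (fun ω hω => ?_) ?_
      · obtain ⟨q, -, hrun⟩ := BicolouredGraph.exists_run hs0 G (k := k) ω
        refine ⟨q, _, hrun, ?_⟩
        rw [Fintype.card_fin] at hω
        have h1 := card_le_card (hM.matched_subset_hopeful k)
        have h2 := hM.mul_card_hopeful_le hdeg k
        have h3 := hM.card_le_mul_card_matched hdeg hiso
        rw [hM.card_matched] at h1 h2 h3
        rw [Fintype.card_fin] at h3
        exact abs_estimate_sub_le hε hΔ hs0 (Nat.succ_pos m) (Nat.le_ceil _) h1 h2 h3 hω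
      · have hcard : Nat.card ((samplingAlgorithm s k).Seed (m + 1)) = (m + 1) ^ s := by
          change Nat.card (Fin s → Fin (m + 1)) = _
          simp
        rw [hcard]
        rw [Fintype.card_fin] at hmain ⊢
        push_cast at hmain ⊢
        exact hmain
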